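/- **Setting.** $\mathcal A$ is a finite set of parameters in a finite-dimensional normed space, $\mathcal X$ and $\mathcal U$ are subsets of finite-dimensional normed spaces, $z$ is Lipschitz on $\mathcal X\times\mathcal U$, $\pi$ maps $\mathcal X\times\mathcal A$ to $\mathcal U$, and for $a\in\mathcal A$ the $\mathcal X$-valued trajectory $x^a$ satisfies $x^a(t)=x_0+\int_0^t z(x^a(\tau),\pi(x^a(\tau),a))\,d\tau$ for $t\ge 0$. States are measured at times $k\Delta t$, $\Delta t>0$; write $x^a(k)$ for $x^a(k\Delta t)$. The objective is $f:\mathcal A\to\mathbb R$ and the constraints are $g_i(a)=g_i(a,x_0)$, $i\in I_g=\{1,\dots,q\}$, where $g_i(a,x)$ is the value of the constraint for policy $a$ and start state $x\in\mathcal X$. Put $I=\{0,\dots,q\}$, $h(a,0)=f(a)$, $h(a,i)=g_i(a)$ for $i\in I_g$. The safe global optimum $a^*$ maximizes $f$ over all $a\in\mathcal A$ with $g_i(a)\ge0$ for all $i\in I_g$. **Assumptions.** (1) $\emptyset\ne S_0\subseteq\mathcal A$ is known and $g_i(a)\ge 0$ for $a\in S_0$, $i\in I_g$. (2) $h$ lies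 in an RKHS on $\mathcal A\times I$ with kernel $k$, and $\|h\|_k\le B$; $f$ and $g_i(\cdot,x_0)$ are $L_a$-Lipschitz and $g_i(a,\cdot)$ is $L_x$-Lipschitz, with known $L_a\ge0$, $L_x>0$. (3) An experiment with parameter $a$ yields $h(a,i)+\epsilon_i$ for every $i\in I$, with i.i.d. $\sigma$-sub-Gaussian noise, $\sigma>0$. (4) For every trajectory $\xi$ of the system under some $a\in\mathcal A$ started in $\mathcal X$, $\|\xi(\rho\Delta t)-\xi(0)\|\le\Xi$ for all $\rho\in[0,1]$. **GoSafeOpt.** Fix $\varepsilon>0$, $\delta\in(0,1)$. Let $\gamma_m=\max\frac12\log\det(I+\sigma^{-2}K)$ over all choices of $m$ (possibly repeated) points of $\mathcal A\times I$ with covariance matrix $K$, and $\beta_n^{1/2}=B+4\sigma\sqrt{\gamma_{n|I|}+1+\ln(1/\delta)}$ for intervals built from the measurements of the (at most $n$) experiments preceding iteration $n$. Start with $l_0(a,i)=0$ for $a\in S_0,i\in I_g$ and $l_0=-\infty$ otherwise, $u_0=\infty$, backups $\mathcal B_0=S_0\times\{x_0\}$, no data, and no failed parameters. For a GP with kernel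 $k$, zero mean and noise variance $\sigma^2$, let $\mu,s$ be the posterior mean and standard deviation given the data available at iteration $n\ge1$; then $l_n=\max\{l_{n-1},\mu-\beta_n^{1/2}s\}$ and $u_n=\min\{u_{n-1},\mu+\beta_n^{1/2}s\}$. Put $w_n=u_n-l_n$ and $$\mathcal G_n=\{a\in S_n:\exists a'\in\mathcal A\setminus S_n,\exists i\in I_g,\ u_n(a,i)-L_a\|a-a'\|\ge0\},\quad \mathcal M_n=\{a\in S_n: u_n(a,0)\ge\max_{a'\in S_n}l_n(a',0)\}.$$ The *boundary condition* triggers at $x$ if for every $(a_s,x_s)\in\mathcal B_n$ there is $i\in I_g$ with $l_n(a_s,i)-L_x(\|x-x_s\|+\Xi)<0$. In iteration $n\ge 0$, first every failed parameter at whose stored fail state the boundary condition no longer triggers is removed from the fail set $\mathcal E$. Local safe exploration (LSE) has *converged* at $n\ge1$ if $\max_{a\in\mathcal G_{n-1}\cup\mathcal M_{n-1}}\max_{i\in I}w_{n-1}(a,i)<\varepsilon$ (which holds if $\mathcal G_{n-1}\cup\mathcal M_{n-1}=\emptyset$) and $S_{n-1}=S_n$; it has not converged at $n=0$. * If LSE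 has not converged, choose $a_n\in\arg\max_{a\in\mathcal G_n\cup\mathcal M_n}\max_{i\in I}w_n(a,i)$, add its measurements to the data and all $(a_n,x^{a_n}(k))$, $k\in\mathbb N$, to the backups (nothing is evaluated if $\mathcal G_n\cup\mathcal M_n=\emptyset$), and set $S_{n+1}=\bigcap_{i\in I_g}\bigcup_{a'\in S_n}\{a\in\mathcal A: l_{n+1}(a',i)-L_a\|a-a'\|\ge0\}$. * Otherwise (global exploration), if $\mathcal A\setminus(S_n\cup\mathcal E)\ne\emptyset$, choose $a_n\in\arg\max_{a\in\mathcal A\setminus(S_n\cup\mathcal E)}\max_{i\in I_g}w_n(a,i)$. If the boundary condition triggers at some $x^{a_n}(k)$, put $a_n$ with the first such state into the fail set. If it triggers at none, add the measurements and the rollout of $a_n$ to the data and backups, put $S_{n+1}=S_n\cup\{a_n\}$, and replace $l_n(a_n,i)$ by $\max\{l_n(a_n,i),0\}$ for $i\in I_g$ before forming $l_{n+1}$. * If LSE has converged and $\mathcal A\setminus(S_n\cup\mathcal E)=\emptyset$, the algorithm stops; all quantities keep their values for later indices. Ties may be broken in any way. Define the safe states $$\mathcal X_n^{\mathrm s}=\bigcup_{(a',x')\in\mathcal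 B_n}\Bigl\{x\in\mathcal X:\|x'-x\|\le\tfrac1{L_x}\min_{i\in I_g}l_n(a',i)-\Xi\Bigr\},$$ the reachability operator $R^c_\varepsilon(S)=S\cup\{a\in\mathcal A:\exists a'\in S\ \forall i\in I_g,\ g_i(a',x_0)-\varepsilon-L_a\|a-a'\|\ge0\}$ and $\bar R^c_\varepsilon(S)=\bigcup_{m\ge0}(R^c_\varepsilon)^m(S)$. A parameter $a$ is *discoverable at iteration $n$* if $a\in\bar R^c_\varepsilon(A)$ for some $A\subseteq S_n$. **Lemma.** Under assumptions (1)–(4), for every $n\ge0$ there is a finite $\tilde n\ge n$ such that, with probability at least $1-\delta$, the following holds: if there is $a_{GE}\in\mathcal A\setminus S_n$ with $x^{a_{GE}}(k)\in\mathcal X^{\mathrm s}_n$ for all $k\ge0$ and $a^*\in\bar R^c_\varepsilon(\{a_{GE}\})$, then $a^*$ is discoverable at iteration $\tilde n$. -/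

import Mathlib

open MeasureTheory ProbabilityTheory
open scoped NNReal ENNReal

noncomputable section

namespace GoSafeOpt

/-! ### Gaussian process regression -/

section GP

variable {Z ι : Type*} [Fintype ι] [DecidableEq ι]

/-- The covariance matrix `K` of the kernel `k` at the sample points `z`. -/
def gram (k : Z → Z → ℝ) (z : ι → Z) : Matrix ι ι ℝ := Matrix.of fun i j => k (z i) (z j)

/-- Posterior mean `k(x) (K + σ² I)⁻¹ Y` of a zero-mean GP, given observations `y` at points `z`. -/
def postMean (k : Z → Z → ℝ) (σ : ℝ) (z : ι → Z) (y : ι → ℝ) (x : Z) : ℝ :=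
  (fun j => k x (z j)) ⬝ᵥ ((gram k z + σ ^ 2 • (1 : Matrix ι ι ℝ))⁻¹.mulVec y)

/-- Posterior variance `k(x,x) - k(x) (K + σ² I)⁻¹ k(x)ᵀ`. -/
def postVar (k : Z → Z → ℝ) (σ : ℝ) (z : ι → Z) (x : Z) : ℝ :=
  k x x - (fun j => k x (z j)) ⬝ᵥ
    ((gram k z + σ ^ 2 • (1 : Matrix ι ι ℝ))⁻¹.mulVec fun j => k x (z j))

/-- Mutual information `½ log det (I + σ⁻² K)` between the GP and noisy observations at `z`. -/
def infoGain (k : Z → Z → ℝ) (σ : ℝ) (z : ι → Z) : ℝ :=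
  1 / 2 * Real.log (1 + (σ ^ 2)⁻¹ • gram k z).det

/-- Maximum information gain `γ_m` over all choices of `m` (possibly repeated) sample points. -/
def maxInfoGain (k : Z → Z → ℝ) (σ : ℝ) (m : ℕ) : ℝ :=
  ⨆ z : Fin m → Z, infoGain k σ z

end GP

/-! ### The controlled system -/

section Dynamics

variable {P E V : Type*} [NormedAddCommGroup E] [NormedSpace ℝ E]

/-- `ξ` is a trajectory in the state space `X` of `dx = z(x, u) dt` started at `x₁`
under the feedback policy `u = π(x, a)`. -/
def IsTrajectory (X : Set E) (z : E → V → E) (π : E → P → V) (a : P) (x₁ : E) (ξ : ℝ → E) :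
    Prop :=
  ∀ t : ℝ, 0 ≤ t → ξ t ∈ X ∧
    IntervalIntegrable (fun τ => z (ξ τ) (π (ξ τ) a)) volume 0 t ∧
    ξ t = x₁ + ∫ τ in (0 : ℝ)..t, z (ξ τ) (π (ξ τ) a)

end Dynamics

/-! ### Objective, constraints, reachability -/

section Reach

variable {𝒜 : Type*} {q : ℕ}

/-- `a` solves: maximize `f` subject to `g i ≥ 0` for all `i`. -/
def IsSafeOptimum (f : 𝒜 → ℝ) (g : Fin q → 𝒜 → ℝ) (a : 𝒜) : Prop :=
  (∀ i, 0 ≤ g i a) ∧ ∀ b, (∀ i, 0 ≤ g i b) → f b ≤ f a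

variable [PseudoMetricSpace 𝒜]

/-- The one-step reachability operator `R^c_ε`. -/
def reach (g : Fin q → 𝒜 → ℝ) (La ε : ℝ) (S : Set 𝒜) : Set 𝒜 :=
  S ∪ {a | ∃ a' ∈ S, ∀ i, 0 ≤ g i a' - ε - La * dist a a'}

/-- Its closure `R̄^c_ε`, the limit of the increasing sets `(R^c_ε)^n (S)`. -/
def reachClosure (g : Fin q → 𝒜 → ℝ) (La ε : ℝ) (S : Set 𝒜) : Set 𝒜 :=
  ⋃ n : ℕ, (reach g La ε)^[n] S

end Reach

/-! ### The algorithm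

Index `0` of `Fin (q + 1)` is the objective, index `i.succ` is the `i`-th constraint. -/

/-- Everything a run of the algorithm depends on, apart from measurement noise and tie-breaking. -/
structure Setup (𝒜 E : Type*) (q : ℕ) where
  /-- kernel of the GP -/
  k : 𝒜 × Fin (q + 1) → 𝒜 × Fin (q + 1) → ℝ
  /-- the function that is measured -/
  h : 𝒜 × Fin (q + 1) → ℝ
  /-- `roll a j` is the state at time step `j` of the rollout of `a` from the initial state -/
  roll : 𝒜 → ℕ → E
  /-- initial state -/
  x₀ : E
  /-- safe seed -/
  S₀ : Set 𝒜
  /-- Lipschitz constant in the parameter -/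
  La : ℝ
  /-- Lipschitz constant in the state -/
  Lx : ℝ
  /-- bound on the one-step jump -/
  Xi : ℝ
  /-- precision -/
  ε : ℝ
  /-- noise level -/
  σ : ℝ
  /-- RKHS norm bound -/
  B : ℝ
  /-- failure probability -/
  δ : ℝ

/-- The variables of the algorithm at the beginning of an iteration. -/
structure State (𝒜 E : Type*) (q : ℕ) where
  /-- safe set -/
  S : Set 𝒜
  /-- lower confidence bound -/
  l : 𝒜 → Fin (q + 1) → EReal
  /-- upper confidence bound -/
  u : 𝒜 → Fin (q + 1) → EReal
  /-- set of backups -/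
  Bk : Set (𝒜 × E)
  /-- dataset: evaluated parameters with the measurements of all outputs -/
  D : List (𝒜 × (Fin (q + 1) → ℝ))
  /-- failed parameters, each with the state where the backup was triggered -/
  Fail : Set (𝒜 × E)
  /-- whether the convergence criterion of local safe exploration holds -/
  lseConv : Prop

section Algorithm

variable {𝒜 E : Type*} {q : ℕ} [PseudoMetricSpace 𝒜] [NormedAddCommGroup E]

/-- The sample points of a dataset; each evaluation measures all `q + 1` outputs. -/
def dataPts (D : List (𝒜 × (Fin (q + 1) → ℝ))) : Fin D.length × Fin (q + 1) → 𝒜 × Fin (q + 1) :=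
  fun j => ((D.get j.1).1, j.2)

/-- The measured values of a dataset. -/
def dataVals (D : List (𝒜 × (Fin (q + 1) → ℝ))) : Fin D.length × Fin (q + 1) → ℝ :=
  fun j => (D.get j.1).2 j.2

namespace Setup

variable (s : Setup 𝒜 E q)

/-- `β^{1/2} = B + 4 σ √(γ + 1 + ln (1/δ))`, where `γ` is the maximum information gain of the
`n (q + 1)` measurements of `n` experiments. -/
def sqrtBeta (n : ℕ) : ℝ :=
  s.B + 4 * s.σ * √(maxInfoGain s.k s.σ (n * (q + 1)) + 1 + Real.log (1 / s.δ))

/-- Update of the lower bounds before iteration `n` with the posterior given `D`. -/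
def newL (n : ℕ) (D : List (𝒜 × (Fin (q + 1) → ℝ))) (l : 𝒜 → Fin (q + 1) → EReal) :
    𝒜 → Fin (q + 1) → EReal := fun a i =>
  max (l a i) ((postMean s.k s.σ (dataPts D) (dataVals D) (a, i) -
    s.sqrtBeta n * √(postVar s.k s.σ (dataPts D) (a, i)) : ℝ) : EReal)

/-- Update of the upper bounds before iteration `n` with the posterior given `D`. -/
def newU (n : ℕ) (D : List (𝒜 × (Fin (q + 1) → ℝ))) (u : 𝒜 → Fin (q + 1) → EReal) :
    𝒜 → Fin (q + 1) → EReal := fun a i =>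
  min (u a i) ((postMean s.k s.σ (dataPts D) (dataVals D) (a, i) +
    s.sqrtBeta n * √(postVar s.k s.σ (dataPts D) (a, i)) : ℝ) : EReal)

/-- Update of the safe set from the lower bounds `l`. -/
def newS (l : 𝒜 → Fin (q + 1) → EReal) (S : Set 𝒜) : Set 𝒜 :=
  ⋂ i : Fin q, ⋃ a' ∈ S, {a | 0 ≤ l a' i.succ - ((s.La * dist a a' : ℝ) : EReal)}

/-- The rollout of `a`, as it is added to the set of backups. -/
def rollout (a : 𝒜) : Set (𝒜 × E) := Set.range fun j : ℕ => (a, s.roll a j)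

/-- The boundary condition at the state `x`: a backup policy is triggered. -/
def Boundary (l : 𝒜 → Fin (q + 1) → EReal) (Bk : Set (𝒜 × E)) (x : E) : Prop :=
  ∀ p ∈ Bk, ∃ i : Fin q, l p.1 i.succ - ((s.Lx * (‖x - p.2‖ + s.Xi) : ℝ) : EReal) < 0

/-- The initial values of the variables. -/
def init : State 𝒜 E q where
  S := s.S₀
  l := open Classical in fun a i => if a ∈ s.S₀ ∧ i ≠ 0 then 0 else ⊥
  u := fun _ _ => ⊤
  Bk := {p | p.1 ∈ s.S₀ ∧ p.2 = s.x₀}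
  D := []
  Fail := ∅
  lseConv := False

end Setup

namespace State

variable (s : Setup 𝒜 E q) (v : State 𝒜 E q)

/-- Width of the confidence interval. -/
def w (a : 𝒜) (i : Fin (q + 1)) : EReal := v.u a i - v.l a i

/-- The expanders. -/
def expanders : Set 𝒜 :=
  {a ∈ v.S | ∃ a' ∉ v.S, ∃ i : Fin q, 0 ≤ v.u a i.succ - ((s.La * dist a a' : ℝ) : EReal)}

/-- The maximizers. -/
def maximizers : Set 𝒜 := {a ∈ v.S | (⨆ a' ∈ v.S, v.l a' 0) ≤ v.u a 0}

/-- The set of safe states (within the state space `X`). -/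
def safeStates (X : Set E) : Set E :=
  ⋃ p ∈ v.Bk, {x ∈ X | ((‖p.2 - x‖ : ℝ) : EReal) ≤
    ((1 / s.Lx : ℝ) : EReal) * (⨅ i : Fin q, v.l p.1 i.succ) - (s.Xi : EReal)}

/-- The fail set, re-evaluated with the current backups and bounds. -/
def fail : Set (𝒜 × E) := {p ∈ v.Fail | s.Boundary v.l v.Bk p.2}

/-- The candidates of global exploration: neither in the safe set nor failed. -/
def geCand : Set 𝒜 := {a | a ∉ v.S ∧ a ∉ Prod.fst '' v.fail s}

/-- The convergence criterion of local safe exploration, for the iteration after `v`,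
which starts with the safe set `S'`. -/
def conv (S' : Set 𝒜) : Prop :=
  (∀ a ∈ v.expanders s ∪ v.maximizers, ∀ i, v.w a i < (s.ε : EReal)) ∧ v.S = S'

/-- The maximizers of `val` over `c`. -/
def argmax (c : Set 𝒜) (val : 𝒜 → EReal) : Set 𝒜 := {a ∈ c | ∀ b ∈ c, val b ≤ val a}

open Classical in
/-- Local safe exploration in iteration `n`, with measurement noise `e` and tie-breaking `pick`.
If there is neither an expander nor a maximizer, no experiment is run. -/
def lse (n : ℕ) (e : Fin (q + 1) → ℝ) (pick : Set 𝒜 → 𝒜) : State 𝒜 E q :=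
  let c := v.expanders s ∪ v.maximizers
  let a := pick (argmax c fun a => ⨆ i, v.w a i)
  let D' := if c.Nonempty then v.D ++ [(a, fun i => s.h (a, i) + e i)] else v.D
  let l' := s.newL (n + 1) D' v.l
  let S' := s.newS l' v.S
  { S := S'
    l := l'
    u := s.newU (n + 1) D' v.u
    Bk := if c.Nonempty then v.Bk ∪ s.rollout a else v.Bk
    D := D'
    Fail := v.fail s
    lseConv := v.conv s S' }

open Classical in
/-- Global exploration in iteration `n`. If the boundary condition is triggered along the rollout
of the chosen parameter, the parameter is marked as failed together with the first such state;
otherwise it is added to the safe set. If no candidate is left, the algorithm has stopped and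
nothing changes. -/
def ge (n : ℕ) (e : Fin (q + 1) → ℝ) (pick : Set 𝒜 → 𝒜) : State 𝒜 E q :=
  let a := pick (argmax (v.geCand s) fun a => ⨆ i : Fin q, v.w a i.succ)
  if ¬ (v.geCand s).Nonempty then { v with Fail := v.fail s }
  else if hb : ∃ j, s.Boundary v.l v.Bk (s.roll a j) then
    { v with
      l := s.newL (n + 1) v.D v.l
      u := s.newU (n + 1) v.D v.u
      Fail := v.fail s ∪ {(a, s.roll a (Nat.find hb))}
      lseConv := v.conv s v.S }
  else
    let D' := v.D ++ [(a, fun i => s.h (a, i) + e i)]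
    let S' := v.S ∪ {a}
    { S := S'
      l := s.newL (n + 1) D' fun b i => if b = a ∧ i ≠ 0 then max (v.l b i) 0 else v.l b i
      u := s.newU (n + 1) D' v.u
      Bk := v.Bk ∪ s.rollout a
      D := D'
      Fail := v.fail s
      lseConv := v.conv s S' }

end State

open Classical in
/-- The state at iteration `n` of the run of the algorithm with noise `e j` and tie-breaking
`pick j` in iteration `j`. -/
def Setup.run (s : Setup 𝒜 E q) (e : ℕ → Fin (q + 1) → ℝ) (pick : ℕ → Set 𝒜 → 𝒜) :
    ℕ → State 𝒜 E q
  | 0 => s.init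
  | n + 1 =>
    let v := s.run e pick n
    if v.lseConv then v.ge s n (e n) (pick n) else v.lse s n (e n) (pick n)

/-- `a` is discoverable at a state of the algorithm: some `A' ⊆ S` has `a ∈ R̄^c_ε(A')`. -/
def State.Discoverable (s : Setup 𝒜 E q) (v : State 𝒜 E q) (a : 𝒜) : Prop :=
  ∃ A' ⊆ v.S, a ∈ reachClosure (fun (i : Fin q) b => s.h (b, i.succ)) s.La s.ε A'

end Algorithm

end GoSafeOpt

end

/-! The claim holds on every sample path. Posterior variances depend on where measurements are
taken, not on their values, and the running maxima and minima make the bounds monotone; no step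
needs the confidence intervals to contain `h`. A parameter whose rollout is safe at iteration `n`
can never count as failed later, because bounds only improve and backups only accumulate
(`mem_geCand_run`). So global exploration has a candidate until that parameter enters the safe set,
and it suffices to bound the time between two growths of the safe set. While the safe set is
constant, an iteration of local exploration that does not converge measures a parameter with some
width at least `ε`, hence one with at most `4 β σ² / ε²` earlier experiments. On a finite domain the
information gain is logarithmic, so `β` is `o(n)` and pigeonhole forces convergence
(`exists_lseConv`). After that, each global iteration either enlarges the safe set or permanently
discards a candidate, as the bounds are frozen without new data (`exists_S_ne_of_lseConv`). Both
bounds are uniform in noise and tie-breaking, and the safe set grows at most as often as there are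
parameters. This gives a deterministic time by which `aGE` is in the safe set, and `{aGE}` witnesses
discoverability. -/

namespace GoSafeOpt

/-! ### Posterior variance and information gain on a finite domain. -/

section GP

/-- A kernel is positive semidefinite if all its finite covariance matrices are. -/
def PosSemidefKernel {Z : Type*} (k : Z → Z → ℝ) : Prop :=
  ∀ (ι : Type) [Fintype ι] [DecidableEq ι] (z : ι → Z), (gram k z).PosSemidef

/-- Expand the nonnegative quadratic form of `M` at `w - M⁻¹ b`. Any test vector `w` then bounds the
posterior variance from above without computing the inverse. -/
theorem two_mul_dotProduct_sub_le {ι : Type*} [Fintype ι] [DecidableEq ι] {M : Matrix ι ι ℝ}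
    (hM : M.PosDef) (b w : ι → ℝ) :
    2 * (w ⬝ᵥ b) - w ⬝ᵥ (M.mulVec w) ≤ b ⬝ᵥ (M⁻¹.mulVec b) := by
  have hu : IsUnit M.det := (Matrix.isUnit_iff_isUnit_det M).1 hM.isUnit
  set y := M⁻¹.mulVec b with hy
  have hMy : M.mulVec y = b := by
    rw [hy, Matrix.mulVec_mulVec, Matrix.mul_nonsing_inv M hu, Matrix.one_mulVec]
  have hsym : y ⬝ᵥ M.mulVec w = w ⬝ᵥ b := by
    have ht : M.transpose = M := by simpa using hM.1.eq
    rw [Matrix.dotProduct_mulVec, ← Matrix.mulVec_transpose, ht, hMy, dotProduct_comm]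
  have h0 := hM.posSemidef.dotProduct_mulVec_nonneg (w - y)
  simp only [star_trivial, Matrix.mulVec_sub, sub_dotProduct, dotProduct_sub, hMy, hsym] at h0
  rw [dotProduct_comm y b] at h0
  linarith

variable {Z : Type*} {k : Z → Z → ℝ} {σ : ℝ}

theorem posDef_gram_add (hk : PosSemidefKernel k) (hσ : 0 < σ) {ι : Type} [Fintype ι]
    [DecidableEq ι] (z : ι → Z) : (gram k z + σ ^ 2 • (1 : Matrix ι ι ℝ)).PosDef :=
  Matrix.PosDef.posSemidef_add (hk ι z) (Matrix.PosDef.one.smul (by positivity))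

theorem posDef_one_add_gram (hk : PosSemidefKernel k) {ι : Type} [Fintype ι]
    [DecidableEq ι] (z : ι → Z) : (1 + (σ ^ 2)⁻¹ • gram k z).PosDef :=
  Matrix.PosDef.one.add_posSemidef ((hk ι z).smul (by positivity))

/-- A point that was sampled `c` times has posterior variance at most `σ² / c`. -/
theorem postVar_le [DecidableEq Z] (hk : PosSemidefKernel k) (hσ : 0 < σ) {ι : Type} [Fintype ι]
    [DecidableEq ι] (z : ι → Z) (x : Z) (hx : ∃ j, z j = x) :
    postVar k σ z x ≤ σ ^ 2 / (Finset.univ.filter fun j => z j = x).card := by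
  classical
  set c : ℝ := ((Finset.univ.filter fun j => z j = x).card : ℝ) with hc
  have hc0 : 0 < c := by
    obtain ⟨j, hj⟩ := hx
    rw [hc, Nat.cast_pos, Finset.card_pos]
    exact ⟨j, by simpa using hj⟩
  -- The test vector averages the `c` observations taken at `x`. The kernel terms cancel, and only
  -- the noise `σ² / c` of the average remains.
  set w : ι → ℝ := fun j => if z j = x then c⁻¹ else 0 with hw
  have sum_w : ∀ F : ι → ℝ, ∀ r, (∀ j, z j = x → F j = r) → w ⬝ᵥ F = r := by
    intro F r h
    have : ∀ j, w j * F j = if z j = x then c⁻¹ * r else 0 := by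
      intro j
      by_cases hj : z j = x
      · simp [hw, hj, h j hj]
      · simp [hw, hj]
    rw [dotProduct, Finset.sum_congr rfl fun j _ => this j, ← Finset.sum_filter,
      Finset.sum_const, nsmul_eq_mul, ← hc]
    field_simp
  have hb : w ⬝ᵥ (fun j => k x (z j)) = k x x := sum_w _ _ fun j hj => by simp [hj]
  have hM : w ⬝ᵥ (gram k z + σ ^ 2 • (1 : Matrix ι ι ℝ)).mulVec w = k x x + σ ^ 2 * c⁻¹ := by
    refine sum_w _ _ fun j hj => ?_
    rw [Matrix.add_mulVec, Pi.add_apply, Matrix.smul_mulVec, Matrix.one_mulVec]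
    congr 1
    · rw [Matrix.mulVec, dotProduct_comm]
      refine sum_w _ _ fun i hi => ?_
      simp [gram, hi, hj]
    · simp [hw, hj]
  have := two_mul_dotProduct_sub_le (posDef_gram_add hk hσ z) (fun j => k x (z j)) w
  rw [hb, hM] at this
  rw [postVar, div_eq_mul_inv]
  linarith

/-- A further sample point multiplies the determinant by a Schur complement, which is at least `1`.
-/
theorem det_one_add_gram_mono (hk : PosSemidefKernel k) {m : ℕ} (z : Fin m → Z) (x : Z) :
    (1 + (σ ^ 2)⁻¹ • gram k z).det ≤
      (1 + (σ ^ 2)⁻¹ • gram k (Sum.elim z fun _ : Fin 1 => x)).det := by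
  set t := (σ ^ 2)⁻¹
  have ht : 0 ≤ t := by positivity
  set A := 1 + t • gram k z with hA
  have hAp : A.PosDef := posDef_one_add_gram hk z
  set b : Matrix (Fin m) (Fin 1) ℝ := Matrix.of fun i _ => t * k (z i) x with hb
  have hsy := (hk _ (Sum.elim z fun _ : Fin 1 => x)).1
  have hblock : 1 + t • gram k (Sum.elim z fun _ : Fin 1 => x) =
      Matrix.fromBlocks A b b.transpose (Matrix.of fun _ _ => 1 + t * k x x) := by
    ext i j
    rcases i with i | i <;> rcases j with j | j
    · simp [hA, gram, Matrix.one_apply]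
    · simp [hb, gram]
    · have := hsy.apply (Sum.inr i) (Sum.inl j)
      simp [gram] at this
      simp [hb, gram, this]
    · obtain rfl := Subsingleton.elim i j
      simp [gram]
  -- Without the `1` in the corner the matrix is still positive semidefinite, being `diag(1, 0)`
  -- plus a scaled Gram matrix. Its Schur complement is thus nonnegative, and restoring the `1`
  -- gives a factor at least `1`.
  have hpsd : (Matrix.fromBlocks A b b.conjTranspose (Matrix.of fun _ _ => t * k x x)).PosSemidef := by
    have h1 : (Matrix.fromBlocks (1 : Matrix (Fin m) (Fin m) ℝ) 0 0
        (0 : Matrix (Fin 1) (Fin 1) ℝ)).PosSemidef := by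
      rw [← Matrix.diagonal_one, ← Matrix.diagonal_zero, Matrix.fromBlocks_diagonal]
      refine Matrix.PosSemidef.diagonal fun i => ?_
      rcases i with i | i <;> simp
    have h2 := h1.add ((hk _ (Sum.elim z fun _ : Fin 1 => x)).smul ht)
    convert h2 using 1
    have h3 : Matrix.fromBlocks A b b.conjTranspose (Matrix.of fun _ _ => t * k x x) =
        Matrix.fromBlocks A b b.transpose (Matrix.of fun _ _ => 1 + t * k x x) -
          Matrix.fromBlocks 0 0 0 1 := by
      ext i j
      rcases i with i | i <;> rcases j with j | j <;> simp
      obtain rfl := Subsingleton.elim i j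
      simp
    rw [h3, ← hblock]
    ext i j
    rcases i with i | i <;> rcases j with j | j <;> simp [Matrix.one_apply]
  have := hAp.isUnit.invertible
  rw [hblock, Matrix.det_fromBlocks₁₁, Matrix.det_fin_one]
  have hs := (Matrix.PosDef.fromBlocks₁₁ b (Matrix.of fun _ _ => t * k x x) hAp).1 hpsd
  have hs0 := hs.diag_nonneg (i := 0)
  refine le_mul_of_one_le_right hAp.det_pos.le ?_
  rw [Matrix.invOf_eq_nonsing_inv]
  simp only [Matrix.sub_apply, Matrix.of_apply, Matrix.conjTranspose_eq_transpose_of_trivial] at hs0 ⊢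
  linarith

theorem infoGain_equiv {ι κ : Type*} [Fintype ι] [DecidableEq ι] [Fintype κ] [DecidableEq κ]
    (e : ι ≃ κ) (z : κ → Z) : infoGain k σ (z ∘ e) = infoGain k σ z := by
  have : 1 + (σ ^ 2)⁻¹ • gram k (z ∘ e) = (1 + (σ ^ 2)⁻¹ • gram k z).submatrix e e := by
    ext i j
    simp [gram, Matrix.one_apply]
  rw [infoGain, this, Matrix.det_submatrix_equiv_self, infoGain]

/-- By `det (1 + A B) = det (1 + B A)`, the determinant has the fixed size of `Z`, and the sample
enters only through its multiplicities. Hence it grows polynomially in `m`. -/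
theorem det_one_add_gram_eq [Fintype Z] [DecidableEq Z] {m : ℕ} (z : Fin m → Z) (t : ℝ) :
    (1 + t • gram k z).det =
      (1 + Matrix.of fun x y => t * k x y * (Finset.univ.filter fun j => z j = y).card :
        Matrix Z Z ℝ).det := by
  let S : Matrix (Fin m) Z ℝ := Matrix.of fun j x => if z j = x then 1 else 0
  let C : Matrix Z Z ℝ := Matrix.of fun x y => t * k x y
  have h1 : t • gram k z = S * (C * S.transpose) := by
    ext i j
    simp [S, C, gram, Matrix.mul_apply]
  rw [h1, Matrix.det_one_add_mul_comm, Matrix.mul_assoc]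
  congr 2
  ext x y
  have h2 : S.transpose * S =
      Matrix.diagonal fun y => ((Finset.univ.filter fun j => z j = y).card : ℝ) := by
    ext x y
    rw [Matrix.mul_apply]
    by_cases hxy : x = y
    · subst hxy
      rw [Matrix.diagonal_apply_eq, Finset.natCast_card_filter]
      refine Finset.sum_congr rfl fun j _ => ?_
      by_cases hj : z j = x <;> simp [S, hj]
    · rw [Matrix.diagonal_apply_ne _ hxy]
      refine Finset.sum_eq_zero fun j _ => ?_
      by_cases hj : z j = x
      · simp [S, hj, hxy]
      · simp [S, hj]
  rw [h2, Matrix.mul_diagonal]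
  simp [C]

variable [Finite Z] [Nonempty Z]

theorem maxInfoGain_mono (hk : PosSemidefKernel k) : Monotone (maxInfoGain k σ) := by
  refine monotone_nat_of_le_succ fun m => ciSup_le fun z => ?_
  obtain ⟨x⟩ := ‹Nonempty Z›
  let e : Fin m ⊕ Fin 1 ≃ Fin (m + 1) := finSumFinEquiv
  calc infoGain k σ z ≤ infoGain k σ (Sum.elim z fun _ : Fin 1 => x) := by
        unfold infoGain
        gcongr
        · exact (posDef_one_add_gram hk z).det_pos
        · exact det_one_add_gram_mono hk z x
    _ = infoGain k σ ((Sum.elim z fun _ : Fin 1 => x) ∘ e.symm) := (infoGain_equiv _ _).symm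
    _ ≤ maxInfoGain k σ (m + 1) := le_ciSup (f := fun z => infoGain k σ z) (Set.finite_range _).bddAbove _

theorem maxInfoGain_nonneg (hk : PosSemidefKernel k) (m : ℕ) : 0 ≤ maxInfoGain k σ m := by
  refine le_trans (le_of_eq ?_) (maxInfoGain_mono hk (Nat.zero_le m))
  simp [maxInfoGain, infoGain]

/-- On a finite domain the maximum information gain grows at most logarithmically. -/
theorem exists_maxInfoGain_le (hk : PosSemidefKernel k) :
    ∃ C c : ℝ, ∀ m : ℕ, 1 ≤ m → maxInfoGain k σ m ≤ C + c * Real.log m := by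
  classical
  have := Fintype.ofFinite Z
  set t := (σ ^ 2)⁻¹
  -- Chosen so that every entry of the reduced matrix is at most `1 + (κ - 1) m ≤ κ m`; the Leibniz
  -- expansion then bounds the determinant by `N! (κ m) ^ N`.
  set κ : ℝ := 1 + ∑ x, ∑ y, |t * k x y|
  have hκ : ∀ x y, |t * k x y| ≤ κ - 1 := fun x y => by
    have h1 : |t * k x y| ≤ ∑ y, |t * k x y| :=
      Finset.single_le_sum (f := fun y => |t * k x y|) (fun _ _ => abs_nonneg _) (Finset.mem_univ y)
    have h2 : ∑ y, |t * k x y| ≤ ∑ x, ∑ y, |t * k x y| :=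
      Finset.single_le_sum (f := fun x => ∑ y, |t * k x y|)
        (fun _ _ => Finset.sum_nonneg fun _ _ => abs_nonneg _) (Finset.mem_univ x)
    simp only [κ]
    linarith
  obtain ⟨x₀⟩ := ‹Nonempty Z›
  have hκ1 : 1 ≤ κ := by linarith [hκ x₀ x₀, abs_nonneg (t * k x₀ x₀)]
  set N := Fintype.card Z
  refine ⟨1 / 2 * (Real.log (Nat.factorial N) + N * Real.log κ), 1 / 2 * N, fun m hm => ?_⟩
  have : Nonempty Z := ⟨x₀⟩
  refine ciSup_le fun z => ?_
  have hm' : (1 : ℝ) ≤ m := by exact_mod_cast hm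
  have hdet : (1 + t • gram k z).det ≤ Nat.factorial N * (κ * m) ^ N := by
    have := Matrix.det_le (abv := AbsoluteValue.abs) (x := κ * m)
      (A := (1 + Matrix.of fun x y => t * k x y * (Finset.univ.filter fun j => z j = y).card :
        Matrix Z Z ℝ)) fun x y => by
      have hcard : ((Finset.univ.filter fun j => z j = y).card : ℝ) ≤ m := by
        have := Finset.card_le_univ (Finset.univ.filter fun j => z j = y)
        rw [Fintype.card_fin] at this
        exact_mod_cast this
      have h1 : |(1 : Matrix Z Z ℝ) x y| ≤ 1 := by
        rw [Matrix.one_apply]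
        split_ifs <;> simp
      simp only [AbsoluteValue.abs_apply, Matrix.add_apply, Matrix.of_apply]
      refine (abs_add_le _ _).trans ?_
      rw [abs_mul, Nat.abs_cast]
      have : |t * k x y| * ((Finset.univ.filter fun j => z j = y).card : ℝ) ≤ (κ - 1) * m :=
        mul_le_mul (hκ x y) hcard (by positivity) (by linarith)
      nlinarith
    rw [← det_one_add_gram_eq, nsmul_eq_mul, AbsoluteValue.abs_apply] at this
    exact (le_abs_self _).trans this
  have hlog := Real.log_le_log (posDef_one_add_gram hk z).det_pos hdet
  rw [Real.log_mul (by positivity) (by positivity), Real.log_pow,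
    Real.log_mul (by positivity) (by positivity)] at hlog
  unfold infoGain
  linarith

end GP
end GoSafeOpt

set_option linter.unusedSectionVars false

namespace GoSafeOpt

section Algorithm

variable {𝒜 E : Type*} {q : ℕ} [PseudoMetricSpace 𝒜] [NormedAddCommGroup E]

/-! ### Monotonicity of the updates and growth of `β`. -/

namespace Setup

variable (s : Setup 𝒜 E q)

/-- The lower end of the confidence interval of iteration `n` given the dataset `D`. -/
noncomputable def lcb (n : ℕ) (D : List (𝒜 × (Fin (q + 1) → ℝ))) (p : 𝒜 × Fin (q + 1)) : ℝ :=
  postMean s.k s.σ (dataPts D) (dataVals D) p -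
    s.sqrtBeta n * √(postVar s.k s.σ (dataPts D) p)

/-- The upper end of the confidence interval of iteration `n` given the dataset `D`. -/
noncomputable def ucb (n : ℕ) (D : List (𝒜 × (Fin (q + 1) → ℝ))) (p : 𝒜 × Fin (q + 1)) : ℝ :=
  postMean s.k s.σ (dataPts D) (dataVals D) p +
    s.sqrtBeta n * √(postVar s.k s.σ (dataPts D) p)

theorem newL_eq (n : ℕ) (D : List (𝒜 × (Fin (q + 1) → ℝ))) (l : 𝒜 → Fin (q + 1) → EReal)
    (a : 𝒜) (i : Fin (q + 1)) : s.newL n D l a i = max (l a i) (s.lcb n D (a, i)) := rfl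

variable {s}

/-- With the data fixed, a larger `β` only widens the interval, so the running maximum gains nothing
from an iteration without an experiment. -/
theorem lcb_anti (hβ : Monotone s.sqrtBeta) {m n : ℕ} (hmn : m ≤ n)
    (D : List (𝒜 × (Fin (q + 1) → ℝ))) (p : 𝒜 × Fin (q + 1)) : s.lcb n D p ≤ s.lcb m D p := by
  unfold lcb
  have := hβ hmn
  gcongr

theorem ucb_mono (hβ : Monotone s.sqrtBeta) {m n : ℕ} (hmn : m ≤ n)
    (D : List (𝒜 × (Fin (q + 1) → ℝ))) (p : 𝒜 × Fin (q + 1)) : s.ucb m D p ≤ s.ucb n D p := by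
  unfold ucb
  have := hβ hmn
  gcongr

theorem newS_mono {l l' : 𝒜 → Fin (q + 1) → EReal} {S S' : Set 𝒜} (hl : l ≤ l') (hS : S ⊆ S') :
    s.newS l S ⊆ s.newS l' S' := by
  intro a ha
  simp only [newS, Set.mem_iInter, Set.mem_iUnion, Set.mem_ofPred_eq, exists_prop] at ha ⊢
  intro i
  obtain ⟨a', ha', h⟩ := ha i
  exact ⟨a', hS ha', h.trans (EReal.sub_le_sub (hl _ _) le_rfl)⟩

theorem Boundary.anti {l l' : 𝒜 → Fin (q + 1) → EReal} {Bk Bk' : Set (𝒜 × E)} (hl : l ≤ l')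
    (hB : Bk ⊆ Bk') {x : E} (h : s.Boundary l' Bk' x) : s.Boundary l Bk x := fun p hp => by
  obtain ⟨i, hi⟩ := h p (hB hp)
  exact ⟨i, (EReal.sub_le_sub (hl _ _) le_rfl).trans_lt hi⟩

theorem monotone_sqrtBeta [Finite 𝒜] [Nonempty 𝒜] (hk : PosSemidefKernel s.k) (hσ : 0 < s.σ) :
    Monotone s.sqrtBeta := by
  intro m n hmn
  have := maxInfoGain_mono (σ := s.σ) hk (Nat.mul_le_mul_right (q + 1) hmn)
  unfold sqrtBeta
  gcongr

theorem sqrtBeta_nonneg (hB : 0 ≤ s.B) (hσ : 0 < s.σ) (n : ℕ) : 0 ≤ s.sqrtBeta n := by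
  unfold sqrtBeta
  positivity

/-- The number of experiments needed to shrink a width below `ε` is proportional to `β`; sublinear
growth lets the iteration count overtake it. -/
theorem isLittleO_sqrtBeta_sq [Finite 𝒜] [Nonempty 𝒜] (hk : PosSemidefKernel s.k)
    (hδ : s.δ ∈ Set.Ioo (0 : ℝ) 1) :
    (fun n => s.sqrtBeta n ^ 2) =o[Filter.atTop] fun n : ℕ => (n : ℝ) := by
  obtain ⟨C, c, hC⟩ := exists_maxInfoGain_le (σ := s.σ) hk
  have hlogδ : 0 ≤ Real.log (1 / s.δ) :=
    Real.log_nonneg (by rw [le_div_iff₀ hδ.1]; linarith [hδ.2])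
  have hcast : Filter.Tendsto (fun n : ℕ => (n : ℝ)) Filter.atTop Filter.atTop :=
    tendsto_natCast_atTop_atTop
  have hconst : ∀ r : ℝ, (fun _ : ℕ => r) =o[Filter.atTop] fun n : ℕ => (n : ℝ) := fun r =>
    (Asymptotics.isLittleO_const_id_atTop r).comp_tendsto hcast
  have hlog : (fun n : ℕ => Real.log n) =o[Filter.atTop] fun n : ℕ => (n : ℝ) :=
    Real.isLittleO_log_id_atTop.comp_tendsto hcast
  -- From `(x + y)² ≤ 2 x² + 2 y²` with `y = 4 σ √(…)`, after splitting `log (n (q + 1))`.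
  set r := 2 * s.B ^ 2 + 32 * s.σ ^ 2 * (C + c * Real.log ((q + 1 : ℕ) : ℝ) + 1 +
    Real.log (1 / s.δ))
  have hmain : (fun n : ℕ => r + 32 * s.σ ^ 2 * c * Real.log n) =o[Filter.atTop]
      fun n : ℕ => (n : ℝ) := (hconst r).add (hlog.const_mul_left _)
  refine Asymptotics.IsBigO.trans_isLittleO (Asymptotics.IsBigO.of_bound 1 ?_) hmain
  filter_upwards [Filter.eventually_ge_atTop 1] with n hn
  have hγ := hC (n * (q + 1)) (Nat.mul_pos hn (Nat.succ_pos q))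
  have hγ0 := maxInfoGain_nonneg (σ := s.σ) hk (n * (q + 1))
  rw [Nat.cast_mul, Real.log_mul (by positivity) (by positivity)] at hγ
  have hsq := Real.sq_sqrt (show 0 ≤ maxInfoGain s.k s.σ (n * (q + 1)) + 1 +
    Real.log (1 / s.δ) by linarith)
  have hle : s.sqrtBeta n ^ 2 ≤ r + 32 * s.σ ^ 2 * c * Real.log n := by
    calc s.sqrtBeta n ^ 2 ≤ 2 * s.B ^ 2 + 32 * s.σ ^ 2 *
          √(maxInfoGain s.k s.σ (n * (q + 1)) + 1 + Real.log (1 / s.δ)) ^ 2 := by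
          unfold sqrtBeta
          nlinarith [sq_nonneg (s.B - 4 * s.σ *
            √(maxInfoGain s.k s.σ (n * (q + 1)) + 1 + Real.log (1 / s.δ)))]
      _ ≤ 2 * s.B ^ 2 + 32 * s.σ ^ 2 * (C + c * (Real.log n + Real.log ((q + 1 : ℕ) : ℝ)) + 1 +
          Real.log (1 / s.δ)) := by
          rw [hsq]
          gcongr
      _ = _ := by simp only [r]; ring
  rw [one_mul, Real.norm_of_nonneg (sq_nonneg _)]
  exact hle.trans (le_abs_self _)

end Setup

open Classical in
/-- The number of experiments with parameter `a` in the dataset `D`. -/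
noncomputable def expCount (D : List (𝒜 × (Fin (q + 1) → ℝ))) (a : 𝒜) : ℕ :=
  (D.map fun p => if p.1 = a then 1 else 0).sum

theorem sum_expCount [Fintype 𝒜] (D : List (𝒜 × (Fin (q + 1) → ℝ))) :
    ∑ a, expCount D a = D.length := by
  classical
  induction D with
  | nil => simp [expCount]
  | cons p D ih =>
    simp only [expCount, List.map_cons, List.sum_cons, List.length_cons] at ih ⊢
    rw [Finset.sum_add_distrib, ih]
    simp [add_comm]

theorem expCount_le_length (D : List (𝒜 × (Fin (q + 1) → ℝ))) (a : 𝒜) :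
    expCount D a ≤ D.length := by
  classical
  induction D with
  | nil => simp [expCount]
  | cons p D ih =>
    simp only [expCount, List.map_cons, List.sum_cons, List.length_cons] at ih ⊢
    split_ifs <;> omega

theorem expCount_append_self (D : List (𝒜 × (Fin (q + 1) → ℝ))) (a : 𝒜) (y : Fin (q + 1) → ℝ) :
    expCount (D ++ [(a, y)]) a = expCount D a + 1 := by
  simp [expCount]

theorem expCount_append_of_ne (D : List (𝒜 × (Fin (q + 1) → ℝ))) {a b : 𝒜} (h : a ≠ b)
    (y : Fin (q + 1) → ℝ) : expCount (D ++ [(a, y)]) b = expCount D b := by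
  simp [expCount, h]

/-- Every experiment measures all outputs, so each experiment with `a` contributes a sample at `(a,
i)`. -/
theorem postVar_dataPts_le {k : 𝒜 × Fin (q + 1) → 𝒜 × Fin (q + 1) → ℝ} {σ : ℝ}
    (hk : PosSemidefKernel k) (hσ : 0 < σ) (D : List (𝒜 × (Fin (q + 1) → ℝ))) (a : 𝒜)
    (i : Fin (q + 1)) (h : 0 < expCount D a) :
    postVar k σ (dataPts D) (a, i) ≤ σ ^ 2 / expCount D a := by
  classical
  have hc : expCount D a = (Finset.univ.filter fun j : Fin D.length => (D.get j).1 = a).card := by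
    rw [expCount, ← Fin.sum_univ_fun_getElem, Finset.card_filter]
    rfl
  have hcard : expCount D a ≤
      (Finset.univ.filter fun j => dataPts D j = (a, i)).card := by
    rw [hc]
    refine Finset.card_le_card_of_injOn (fun j => (j, i)) (fun j hj => ?_) fun j _ j' _ h => ?_
    · simpa [dataPts] using hj
    · simpa using h
  have hpos := h.trans_le hcard
  obtain ⟨j, hj⟩ := Finset.card_pos.1 hpos
  refine (postVar_le hk hσ _ _ ⟨j, (Finset.mem_filter.1 hj).2⟩).trans ?_
  have : (0 : ℝ) < expCount D a := by exact_mod_cast h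
  gcongr

/-! ### Effect of a single iteration. -/

namespace State

variable {s : Setup 𝒜 E q} {v v' : State 𝒜 E q}

/-- `v'` knows at least as much as `v`. -/
structure Refines (v v' : State 𝒜 E q) : Prop where
  S : v.S ⊆ v'.S
  l : v.l ≤ v'.l
  u : v'.u ≤ v.u
  Bk : v.Bk ⊆ v'.Bk

theorem Refines.refl (v : State 𝒜 E q) : Refines v v :=
  ⟨subset_rfl, le_rfl, le_rfl, subset_rfl⟩

theorem Refines.trans {v₁ v₂ v₃ : State 𝒜 E q} (h : Refines v₁ v₂) (h' : Refines v₂ v₃) :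
    Refines v₁ v₃ :=
  ⟨h.S.trans h'.S, h.l.trans h'.l, h'.u.trans h.u, h.Bk.trans h'.Bk⟩

/-- With the safe set fixed, better bounds shrink the widths as well as the sets of expanders and
maximizers, so convergence persists. -/
theorem Refines.conv (h : Refines v v') (hS : v.S = v'.S) (hc : v.conv s v.S) :
    v'.conv s v'.S := by
  refine ⟨fun a ha i => ?_, rfl⟩
  refine (EReal.sub_le_sub (h.u a i) (h.l a i)).trans_lt (hc.1 a ?_ i)
  rcases ha with ⟨ha, a', ha', i, hi⟩ | ⟨ha, hm⟩
  · exact Or.inl ⟨hS ▸ ha, a', hS ▸ ha', i, hi.trans (EReal.sub_le_sub (h.u _ _) le_rfl)⟩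
  · refine Or.inr ⟨hS ▸ ha, le_trans ?_ (hm.trans (h.u _ _))⟩
    rw [hS]
    exact iSup₂_mono fun a' _ => h.l a' 0

theorem not_boundary_of_mem_safeStates (hLx : 0 < s.Lx) {X : Set E} {x : E}
    (h : x ∈ v.safeStates s X) : ¬ s.Boundary v.l v.Bk x := by
  intro hb
  simp only [safeStates, Set.mem_iUnion, Set.mem_ofPred_eq, exists_prop] at h
  obtain ⟨p, hp, -, hle⟩ := h
  obtain ⟨i, hi⟩ := hb p hp
  have hinf : (⨅ i : Fin q, v.l p.1 i.succ) ≤ v.l p.1 i.succ := iInf_le _ i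
  refine absurd (EReal.sub_le_sub hinf le_rfl) (not_le.2 (hi.trans_le ?_))
  generalize (⨅ i : Fin q, v.l p.1 i.succ) = y at hle
  have hLx' : 0 < 1 / s.Lx := by positivity
  -- An infinite lower bound is harmless: `⊥` certifies no state, and `⊤` makes the required
  -- inequality trivial.
  induction y with
  | bot =>
    rw [EReal.coe_mul_bot_of_pos hLx', EReal.bot_sub, le_bot_iff] at hle
    exact absurd hle (EReal.coe_ne_bot _)
  | top => rw [EReal.top_sub_coe]; exact le_top
  | coe y =>
    rw [← EReal.coe_mul, ← EReal.coe_sub, EReal.coe_le_coe_iff] at hle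
    rw [← EReal.coe_sub, ← EReal.coe_zero, EReal.coe_le_coe_iff]
    rw [norm_sub_rev] at hle
    have h1 : ‖x - p.2‖ + s.Xi ≤ y / s.Lx := by rw [div_eq_mul_one_div, mul_comm]; linarith
    have h2 := (le_div_iff₀ hLx).1 h1
    linarith

/-- The invariants of the algorithm at the beginning of iteration `n`. -/
structure Invariant (s : Setup 𝒜 E q) (n : ℕ) (v : State 𝒜 E q) : Prop where
  -- This makes the safe set monotone: `newS` is not a union with the old set and could otherwise
  -- drop members.
  safe : v.S ⊆ s.newS v.l v.S
  fail : ∀ p ∈ v.Fail, ∃ j, p.2 = s.roll p.1 j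
  conv : v.lseConv → v.conv s v.S
  started : v.lseConv → 1 ≤ n
  length : v.D.length ≤ n
  lower : 1 ≤ n → ∀ a i, (s.lcb n v.D (a, i) : EReal) ≤ v.l a i
  upper : 1 ≤ n → ∀ a i, v.u a i ≤ (s.ucb n v.D (a, i) : EReal)

theorem invariant_init (s : Setup 𝒜 E q) : Invariant s 0 s.init where
  safe a ha := by
    simp only [Setup.newS, Set.mem_iInter, Set.mem_iUnion, Set.mem_ofPred_eq, exists_prop]
    exact fun i => ⟨a, ha, by simp_all [Setup.init]⟩
  fail p hp := hp.elim
  conv h := h.elim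
  started h := h.elim
  length := le_rfl
  lower h := by omega
  upper h := by omega

/-- The parameter chosen by local safe exploration. -/
noncomputable def lseChoice (s : Setup 𝒜 E q) (v : State 𝒜 E q) (pick : Set 𝒜 → 𝒜) : 𝒜 :=
  pick (argmax (v.expanders s ∪ v.maximizers) fun a => ⨆ i, v.w a i)

/-- The parameter chosen by global exploration. -/
noncomputable def geChoice (s : Setup 𝒜 E q) (v : State 𝒜 E q) (pick : Set 𝒜 → 𝒜) : 𝒜 :=
  pick (argmax (v.geCand s) fun a => ⨆ i : Fin q, v.w a i.succ)

theorem argmax_nonempty [Finite 𝒜] {c : Set 𝒜} (hc : c.Nonempty) (val : 𝒜 → EReal) :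
    (argmax c val).Nonempty := by
  obtain ⟨a, ha, h⟩ := Set.exists_max_image c val c.toFinite hc
  exact ⟨a, ha, h⟩

theorem geChoice_mem [Finite 𝒜] {pick : Set 𝒜 → 𝒜} (hpick : ∀ c, c.Nonempty → pick c ∈ c)
    (hc : (v.geCand s).Nonempty) : v.geChoice s pick ∈ v.geCand s :=
  (hpick _ (argmax_nonempty hc _)).1

variable {n : ℕ} {e : Fin (q + 1) → ℝ} {pick : Set 𝒜 → 𝒜}

theorem Invariant.refines_lse (h : Invariant s n v) : Refines v (v.lse s n e pick) where
  S := h.safe.trans (Setup.newS_mono (fun _ _ => le_max_left _ _) subset_rfl)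
  l _ _ := le_max_left _ _
  u _ _ := min_le_left _ _
  Bk := by
    simp only [lse]
    split_ifs
    · exact Set.subset_union_left
    · exact subset_rfl

theorem Invariant.lse (h : Invariant s n v) : Invariant s (n + 1) (v.lse s n e pick) where
  safe := Setup.newS_mono le_rfl h.refines_lse.S
  fail p hp := h.fail p hp.1
  conv hc := h.refines_lse.conv hc.2 ⟨hc.1, rfl⟩
  started _ := Nat.le_add_left 1 n
  length := by
    have := h.length
    simp only [State.lse]
    split_ifs
    · simpa using this
    · omega
  lower _ _ _ := le_max_right _ _
  upper _ _ _ := min_le_right _ _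

theorem ge_of_not_nonempty (hc : ¬ (v.geCand s).Nonempty) :
    v.ge s n e pick = { v with Fail := v.fail s } := if_pos hc

open Classical in
theorem ge_of_boundary (hc : (v.geCand s).Nonempty)
    (hb : ∃ j, s.Boundary v.l v.Bk (s.roll (v.geChoice s pick) j)) :
    v.ge s n e pick = { v with
      l := s.newL (n + 1) v.D v.l
      u := s.newU (n + 1) v.D v.u
      Fail := v.fail s ∪ {(v.geChoice s pick, s.roll (v.geChoice s pick) (Nat.find hb))}
      lseConv := v.conv s v.S } := (if_neg (not_not.2 hc)).trans (dif_pos hb)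

open Classical in
theorem ge_of_not_boundary (hc : (v.geCand s).Nonempty)
    (hb : ¬ ∃ j, s.Boundary v.l v.Bk (s.roll (v.geChoice s pick) j)) :
    v.ge s n e pick =
      { S := v.S ∪ {v.geChoice s pick}
        l := s.newL (n + 1)
          (v.D ++ [(v.geChoice s pick, fun i => s.h (v.geChoice s pick, i) + e i)])
          fun b i => if b = v.geChoice s pick ∧ i ≠ 0 then max (v.l b i) 0 else v.l b i
        u := s.newU (n + 1)
          (v.D ++ [(v.geChoice s pick, fun i => s.h (v.geChoice s pick, i) + e i)]) v.u
        Bk := v.Bk ∪ s.rollout (v.geChoice s pick)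
        D := v.D ++ [(v.geChoice s pick, fun i => s.h (v.geChoice s pick, i) + e i)]
        Fail := v.fail s
        lseConv := v.conv s (v.S ∪ {v.geChoice s pick}) } :=
  (if_neg (not_not.2 hc)).trans (dif_neg hb)

theorem refines_ge : Refines v (v.ge s n e pick) := by
  classical
  by_cases hc : (v.geCand s).Nonempty
  · by_cases hb : ∃ j, s.Boundary v.l v.Bk (s.roll (v.geChoice s pick) j)
    · rw [ge_of_boundary hc hb]
      exact ⟨subset_rfl, fun _ _ => le_max_left _ _, fun _ _ => min_le_left _ _, subset_rfl⟩
    · rw [ge_of_not_boundary hc hb]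
      refine ⟨Set.subset_union_left, fun a i => le_trans ?_ (le_max_left _ _),
        fun _ _ => min_le_left _ _, Set.subset_union_left⟩
      dsimp only
      split_ifs
      · exact le_max_left _ _
      · exact le_rfl
  · rw [ge_of_not_nonempty hc]
    exact ⟨subset_rfl, le_rfl, le_rfl, subset_rfl⟩

theorem Invariant.ge (h : Invariant s n v) (hβ : Monotone s.sqrtBeta) (hl : v.lseConv) :
    Invariant s (n + 1) (v.ge s n e pick) := by
  classical
  by_cases hc : (v.geCand s).Nonempty
  · by_cases hb : ∃ j, s.Boundary v.l v.Bk (s.roll (v.geChoice s pick) j)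
    · have hr := refines_ge (s := s) (v := v) (n := n) (e := e) (pick := pick)
      rw [ge_of_boundary hc hb] at hr ⊢
      refine ⟨h.safe.trans (Setup.newS_mono hr.l subset_rfl), ?_, fun hc => hr.conv rfl hc,
        fun _ => Nat.le_add_left 1 n, h.length.trans (Nat.le_succ n),
        fun _ _ _ => le_max_right _ _, fun _ _ _ => min_le_right _ _⟩
      rintro p (hp | hp)
      · exact h.fail p hp.1
      · rw [Set.mem_singleton_iff] at hp
        exact ⟨_, by rw [hp]⟩
    · have hr := refines_ge (s := s) (v := v) (n := n) (e := e) (pick := pick)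
      rw [ge_of_not_boundary hc hb] at hr ⊢
      refine ⟨Set.union_subset (h.safe.trans (Setup.newS_mono hr.l hr.S)) ?_,
        fun p hp => h.fail p hp.1, fun hc => hr.conv hc.2 ⟨hc.1, rfl⟩,
        fun _ => Nat.le_add_left 1 n, by simpa using h.length,
        fun _ _ _ => le_max_right _ _, fun _ _ _ => min_le_right _ _⟩
      rw [Set.singleton_subset_iff]
      simp only [Setup.newS, Set.mem_iInter, Set.mem_iUnion, Set.mem_ofPred_eq, exists_prop]
      -- The new parameter supports itself at distance zero, because its lower bounds were raised to
      -- at least `0`.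
      refine fun i => ⟨v.geChoice s pick, Or.inr rfl, ?_⟩
      rw [dist_self, mul_zero, EReal.coe_zero, sub_zero, Setup.newL_eq]
      refine le_trans ?_ (le_max_left _ _)
      rw [if_pos ⟨rfl, Fin.succ_ne_zero i⟩]
      exact le_max_right _ _
  · rw [ge_of_not_nonempty hc]
    -- In the stopped state the bounds keep their values while the index advances; monotonicity of
    -- `β` preserves the comparison with the posterior.
    have hn := h.started hl
    exact ⟨h.safe, fun p hp => h.fail p hp.1, h.conv, fun _ => Nat.le_add_left 1 n,
      h.length.trans (Nat.le_succ n),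
      fun _ a i => (EReal.coe_le_coe_iff.2 (Setup.lcb_anti hβ (Nat.le_succ n) _ _)).trans
        (h.lower hn a i),
      fun _ a i => (h.upper hn a i).trans
        (EReal.coe_le_coe_iff.2 (Setup.ucb_mono hβ (Nat.le_succ n) _ _))⟩

/-- An iteration of global exploration that leaves the safe set unchanged though there are
candidates discards one of them, and local safe exploration remains converged. -/
theorem Invariant.geCand_ge_ssubset [Finite 𝒜] (h : Invariant s n v) (hβ : Monotone s.sqrtBeta)
    (hl : v.lseConv) (hpick : ∀ c, c.Nonempty → pick c ∈ c) (hc : (v.geCand s).Nonempty)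
    (hS : v.S = (v.ge s n e pick).S) :
    (v.ge s n e pick).lseConv ∧ (v.ge s n e pick).geCand s ⊂ v.geCand s := by
  classical
  have ha := geChoice_mem hpick hc
  by_cases hb : ∃ j, s.Boundary v.l v.Bk (s.roll (v.geChoice s pick) j)
  · have hn := h.started hl
    -- A failed rollout adds no data, so lower bounds and backups are unchanged, and earlier
    -- failures remain failures.
    have hnewL : s.newL (n + 1) v.D v.l = v.l := by
      ext a i
      rw [Setup.newL_eq, max_eq_left]
      exact (EReal.coe_le_coe_iff.2 (Setup.lcb_anti hβ (Nat.le_succ n) _ _)).trans (h.lower hn a i)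
    rw [ge_of_boundary hc hb, hnewL]
    refine ⟨h.conv hl, fun a ⟨haS, haF⟩ => ⟨haS, ?_⟩, fun hsub => ?_⟩
    · rintro ⟨p, hp, rfl⟩
      exact haF ⟨p, ⟨Or.inl hp, hp.2⟩, rfl⟩
    · exact (hsub ha).2 ⟨(v.geChoice s pick, s.roll (v.geChoice s pick) (Nat.find hb)),
        ⟨Or.inr rfl, Nat.find_spec hb⟩, rfl⟩
  · rw [ge_of_not_boundary hc hb] at hS
    have : v.geChoice s pick ∈ v.S := by
      rw [hS]
      exact Or.inr rfl
    exact absurd this ha.1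

/-- The confidence intervals of a parameter are short after many experiments with it. -/
theorem Invariant.expCount_mul_le (h : Invariant s n v) (hk : PosSemidefKernel s.k)
    (hσ : 0 < s.σ) (hβ : 0 ≤ s.sqrtBeta n) (hε : 0 < s.ε) {a : 𝒜} {i : Fin (q + 1)}
    (hw : (s.ε : EReal) ≤ v.w a i) :
    expCount v.D a * s.ε ^ 2 ≤ 4 * s.sqrtBeta n ^ 2 * s.σ ^ 2 := by
  -- A parameter without experiments may have an infinite width, but its count is zero. A positive
  -- count forces `1 ≤ n`, where the posterior bounds apply.
  rcases Nat.eq_zero_or_pos (expCount v.D a) with h0 | hpos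
  · rw [h0]
    simp only [Nat.cast_zero, zero_mul]
    positivity
  have hn : 1 ≤ n := hpos.trans_le ((expCount_le_length _ _).trans h.length)
  have h1 := hw.trans (EReal.sub_le_sub (h.upper hn a i) (h.lower hn a i))
  rw [← EReal.coe_sub, EReal.coe_le_coe_iff] at h1
  have hc : (0 : ℝ) < expCount v.D a := by exact_mod_cast hpos
  have h2 : s.ε ≤ 2 * s.sqrtBeta n * √(s.σ ^ 2 / expCount v.D a) := by
    calc s.ε ≤ 2 * s.sqrtBeta n * √(postVar s.k s.σ (dataPts v.D) (a, i)) := by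
          unfold Setup.ucb Setup.lcb at h1
          linarith
      _ ≤ _ := by
          have := postVar_dataPts_le hk hσ v.D a i hpos
          gcongr
  have h3 := pow_le_pow_left₀ hε.le h2 2
  rw [mul_pow, Real.sq_sqrt (by positivity), ← mul_div_assoc, le_div_iff₀ hc] at h3
  linarith

/-- An iteration of local safe exploration that leaves the safe set unchanged but does not
converge runs an experiment with a parameter that has not been evaluated often. -/
theorem Invariant.exists_lse_D_eq [Finite 𝒜] (h : Invariant s n v) (hk : PosSemidefKernel s.k)
    (hσ : 0 < s.σ) (hβ : 0 ≤ s.sqrtBeta n) (hε : 0 < s.ε)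
    (hpick : ∀ c, c.Nonempty → pick c ∈ c) (hS : v.S = (v.lse s n e pick).S)
    (hl : ¬ (v.lse s n e pick).lseConv) :
    ∃ a y, (v.lse s n e pick).D = v.D ++ [(a, y)] ∧
      expCount v.D a * s.ε ^ 2 ≤ 4 * s.sqrtBeta n ^ 2 * s.σ ^ 2 := by
  -- As the safe set did not change, convergence can only have failed through a wide interval; the
  -- maximizing choice is then at least as wide.
  have hw : ∃ a ∈ v.expanders s ∪ v.maximizers, ∃ i, (s.ε : EReal) ≤ v.w a i := by
    by_contra! hcon
    exact hl ⟨hcon, hS⟩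
  obtain ⟨b, hb, j, hj⟩ := hw
  have hne : (v.expanders s ∪ v.maximizers).Nonempty := ⟨b, hb⟩
  have ha : v.lseChoice s pick ∈
      argmax (v.expanders s ∪ v.maximizers) fun a => ⨆ i, v.w a i :=
    hpick _ (argmax_nonempty hne _)
  obtain ⟨i, hi⟩ := exists_eq_ciSup_of_finite (f := fun i => v.w (v.lseChoice s pick) i)
  refine ⟨v.lseChoice s pick, fun i => s.h (v.lseChoice s pick, i) + e i, if_pos hne,
    h.expCount_mul_le hk hσ hβ hε (i := i) ?_⟩
  rw [hi]
  exact hj.trans ((le_iSup (fun i => v.w b i) j).trans (ha.2 b hb))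

end State

/-! ### Time bounds along whole runs. -/

namespace Setup

variable {s : Setup 𝒜 E q} {e : ℕ → Fin (q + 1) → ℝ} {pick : ℕ → Set 𝒜 → 𝒜} {n m : ℕ}

theorem run_succ_of_lseConv (h : (s.run e pick n).lseConv) :
    s.run e pick (n + 1) = (s.run e pick n).ge s n (e n) (pick n) := if_pos h

theorem run_succ_of_not_lseConv (h : ¬ (s.run e pick n).lseConv) :
    s.run e pick (n + 1) = (s.run e pick n).lse s n (e n) (pick n) := if_neg h

theorem invariant_run (hβ : Monotone s.sqrtBeta) : State.Invariant s n (s.run e pick n) := by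
  induction n with
  | zero => exact State.invariant_init s
  | succ n ih =>
    by_cases h : (s.run e pick n).lseConv
    · rw [run_succ_of_lseConv h]
      exact ih.ge hβ h
    · rw [run_succ_of_not_lseConv h]
      exact ih.lse

theorem refines_run (hβ : Monotone s.sqrtBeta) (hmn : m ≤ n) :
    State.Refines (s.run e pick m) (s.run e pick n) := by
  induction n, hmn using Nat.le_induction with
  | base => exact .refl _
  | succ n _ ih =>
    refine ih.trans ?_
    by_cases h : (s.run e pick n).lseConv
    · rw [run_succ_of_lseConv h]
      exact State.refines_ge
    · rw [run_succ_of_not_lseConv h]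
      exact (invariant_run hβ).refines_lse

/-- A parameter whose rollout is safe stays a candidate of global exploration until it is added
to the safe set. -/
theorem mem_geCand_run (hβ : Monotone s.sqrtBeta) (hLx : 0 < s.Lx) {X : Set E} {a : 𝒜}
    (ha : ∀ j, s.roll a j ∈ (s.run e pick n).safeStates s X) (hnm : n ≤ m)
    (haS : a ∉ (s.run e pick m).S) : a ∈ (s.run e pick m).geCand s := by
  refine ⟨haS, ?_⟩
  rintro ⟨p, hp, rfl⟩
  obtain ⟨j, hj⟩ := (invariant_run hβ).fail p hp.1
  have hr := refines_run (e := e) (pick := pick) hβ hnm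
  -- A trigger at the stored rollout state under the later bounds and backups would also be one at
  -- iteration `n`, where that state is safe.
  exact State.not_boundary_of_mem_safeStates hLx (ha j) (Boundary.anti hr.l hr.Bk (hj ▸ hp.2))

/-- While the safe set is unchanged, local safe exploration converges after boundedly many
iterations. -/
theorem exists_lseConv [Fintype 𝒜] (hk : PosSemidefKernel s.k) (hσ : 0 < s.σ) (hB : 0 ≤ s.B)
    (hβ : Monotone s.sqrtBeta) (hε : 0 < s.ε) (hpick : ∀ n c, c.Nonempty → pick n c ∈ c)
    (hmn : m ≤ n)
    (hlong : Fintype.card 𝒜 * (m + (4 * s.sqrtBeta n ^ 2 * s.σ ^ 2 / s.ε ^ 2 + 1)) < (n : ℝ) - m)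
    (hS : ∀ k, m ≤ k → k ≤ n → (s.run e pick k).S = (s.run e pick m).S) :
    ∃ k, m ≤ k ∧ k ≤ n ∧ (s.run e pick k).lseConv := by
  by_contra! hcon
  set M := 4 * s.sqrtBeta n ^ 2 * s.σ ^ 2 / s.ε ^ 2 with hM
  have hM0 : 0 ≤ M := by positivity
  -- Each iteration adds an experiment, yet no count exceeds `m + (M + 1)`: at most `m` experiments
  -- precede iteration `m`, and a parameter is chosen only while its count is at most `M`. Summing
  -- the counts contradicts `hlong`.
  have key : ∀ k, m ≤ k → k ≤ n → k - m ≤ (s.run e pick k).D.length ∧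
      ∀ a, (expCount (s.run e pick k).D a : ℝ) ≤ m + (M + 1) := by
    intro k hk1
    induction k, hk1 using Nat.le_induction with
    | base =>
      intro _
      refine ⟨by simp, fun a => ?_⟩
      have : expCount (s.run e pick m).D a ≤ m :=
        (expCount_le_length _ _).trans (invariant_run hβ).length
      have : (expCount (s.run e pick m).D a : ℝ) ≤ m := by exact_mod_cast this
      linarith
    | succ k hmk ih =>
      intro hkn
      obtain ⟨ih1, ih2⟩ := ih (by omega)
      have hrun := run_succ_of_not_lseConv (hcon k hmk (by omega))
      have hl := hcon (k + 1) (by omega) hkn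
      have hSk := (hS k hmk (by omega)).trans (hS (k + 1) (by omega) hkn).symm
      rw [hrun] at hl hSk ⊢
      obtain ⟨a, y, hD, ha⟩ := (invariant_run hβ).exists_lse_D_eq hk hσ (sqrtBeta_nonneg hB hσ k)
        hε (hpick k) hSk hl
      rw [hD]
      refine ⟨by rw [List.length_append, List.length_singleton]; omega, fun b => ?_⟩
      by_cases hab : a = b
      · subst hab
        rw [expCount_append_self, Nat.cast_add, Nat.cast_one]
        have hle : (expCount (s.run e pick k).D a : ℝ) ≤ M := by
          rw [hM, le_div_iff₀ (by positivity)]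
          refine ha.trans ?_
          have h1 := hβ (show k ≤ n by omega)
          have h2 := sqrtBeta_nonneg hB hσ k
          gcongr
        have : (0 : ℝ) ≤ m := Nat.cast_nonneg m
        linarith
      · rw [expCount_append_of_ne _ hab]
        exact ih2 b
  obtain ⟨h1, h2⟩ := key n hmn le_rfl
  have h3 : ((n : ℝ) - m) ≤ (s.run e pick n).D.length := by
    rw [← Nat.cast_sub hmn]
    exact_mod_cast h1
  have h4 : ((s.run e pick n).D.length : ℝ) ≤ Fintype.card 𝒜 * (m + (M + 1)) := by
    rw [← sum_expCount, Nat.cast_sum]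
    refine (Finset.sum_le_card_nsmul _ _ _ fun a _ => h2 a).trans ?_
    rw [nsmul_eq_mul, Finset.card_univ]
  linarith

/-- Global exploration extends the safe set after at most as many iterations as there are
parameters, as long as candidates remain. -/
theorem exists_S_ne_of_lseConv [Finite 𝒜] (hβ : Monotone s.sqrtBeta)
    (hpick : ∀ n c, c.Nonempty → pick n c ∈ c) (hl : (s.run e pick m).lseConv)
    (hc : ∀ k, m ≤ k → k ≤ m + Nat.card 𝒜 → ((s.run e pick k).geCand s).Nonempty) :
    ∃ k, m ≤ k ∧ k ≤ m + Nat.card 𝒜 + 1 ∧ (s.run e pick k).S ≠ (s.run e pick m).S := by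
  by_contra! hcon
  -- If the safe set stays fixed, every iteration strictly shrinks the candidates, which is
  -- impossible `Nat.card 𝒜 + 1` times.
  have key : ∀ j, j ≤ Nat.card 𝒜 + 1 → (s.run e pick (m + j)).lseConv ∧
      ((s.run e pick (m + j)).geCand s).ncard + j ≤ Nat.card 𝒜 := by
    intro j
    induction j with
    | zero => exact fun _ => ⟨hl, by simpa using Set.ncard_le_card _⟩
    | succ j ih =>
      intro hj
      obtain ⟨ih1, ih2⟩ := ih (by omega)
      have hrun := run_succ_of_lseConv ih1
      have hS := (hcon (m + j) (by omega) (by omega)).trans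
        (hcon (m + j + 1) (by omega) (by omega)).symm
      rw [hrun] at hS
      have := (invariant_run hβ).geCand_ge_ssubset hβ ih1 (hpick _)
        (hc (m + j) (by omega) (by omega)) hS
      rw [← add_assoc, hrun]
      refine ⟨this.1, ?_⟩
      have := Set.ncard_lt_ncard this.2 (Set.toFinite _)
      omega
  have := (key (Nat.card 𝒜 + 1) le_rfl).2
  omega

/-- There is a number of iterations, independent of noise and tie-breaking, after which the safe
set has grown, if candidates of global exploration remain. -/
theorem exists_forall_S_ssubset [Finite 𝒜] [Nonempty 𝒜] (hk : PosSemidefKernel s.k)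
    (hσ : 0 < s.σ) (hB : 0 ≤ s.B) (hε : 0 < s.ε) (hδ : s.δ ∈ Set.Ioo (0 : ℝ) 1) (m : ℕ) :
    ∃ T ≥ m, ∀ (e : ℕ → Fin (q + 1) → ℝ) (pick : ℕ → Set 𝒜 → 𝒜),
      (∀ n c, c.Nonempty → pick n c ∈ c) →
      (∀ k, m ≤ k → k ≤ T → ((s.run e pick k).geCand s).Nonempty) →
      (s.run e pick m).S ⊂ (s.run e pick T).S := by
  have := Fintype.ofFinite 𝒜
  have hβ := monotone_sqrtBeta hk hσ
  -- The left side is `o(n)`, so it is eventually at most half of `n` after moving `m` across.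
  obtain ⟨n, hmn, hlong⟩ : ∃ n ≥ m, Fintype.card 𝒜 *
      (m + (4 * s.sqrtBeta n ^ 2 * s.σ ^ 2 / s.ε ^ 2 + 1)) < (n : ℝ) - m := by
    have hcast : Filter.Tendsto (fun n : ℕ => (n : ℝ)) Filter.atTop Filter.atTop :=
      tendsto_natCast_atTop_atTop
    set N : ℝ := (Fintype.card 𝒜 : ℝ)
    have h1 : (fun n : ℕ => (N * (m + 1) + m) + N * 4 * s.σ ^ 2 / s.ε ^ 2 * s.sqrtBeta n ^ 2)
        =o[Filter.atTop] fun n : ℕ => (n : ℝ) :=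
      ((Asymptotics.isLittleO_const_id_atTop _).comp_tendsto hcast).add
        ((isLittleO_sqrtBeta_sq hk hδ).const_mul_left _)
    have h2 := h1.bound (show (0 : ℝ) < 1 / 2 by norm_num)
    obtain ⟨n, hn, hnm, hn1⟩ := (h2.and ((Filter.eventually_ge_atTop m).and
      (Filter.eventually_ge_atTop 1))).exists
    refine ⟨n, hnm, ?_⟩
    have hn' : (1 : ℝ) ≤ n := by exact_mod_cast hn1
    rw [Real.norm_of_nonneg (Nat.cast_nonneg n)] at hn
    have h3 := (le_abs_self _).trans hn
    have h4 : N * (m + (4 * s.sqrtBeta n ^ 2 * s.σ ^ 2 / s.ε ^ 2 + 1)) + m =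
      (N * (m + 1) + m) + N * 4 * s.σ ^ 2 / s.ε ^ 2 * s.sqrtBeta n ^ 2 := by ring
    linarith
  -- Local exploration converges by iteration `n`; the remaining `Nat.card 𝒜 + 1` iterations suffice
  -- for global exploration.
  refine ⟨n + Nat.card 𝒜 + 1, by omega, fun e pick hpick hc => ?_⟩
  have hmono : ∀ {j k}, j ≤ k → (s.run e pick j).S ⊆ (s.run e pick k).S :=
    fun h => (refines_run hβ h).S
  refine (hmono (by omega)).ssubset_of_ne fun heq => ?_
  have hS : ∀ k, m ≤ k → k ≤ n + Nat.card 𝒜 + 1 → (s.run e pick k).S = (s.run e pick m).S :=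
    fun k h1 h2 => ((hmono h2).trans heq.ge).antisymm (hmono h1)
  obtain ⟨k, hmk, hkn, hl⟩ := exists_lseConv hk hσ hB hβ hε hpick hmn hlong
    fun k h1 h2 => hS k h1 (by omega)
  obtain ⟨j, hkj, hj, hne⟩ := exists_S_ne_of_lseConv hβ hpick hl
    fun j h1 h2 => hc j (by omega) (by omega)
  exact hne ((hS j (by omega) (by omega)).trans (hS k hmk (by omega)).symm)

/-- A parameter with a safe rollout belongs to the safe set after a number of iterations that does
not depend on noise and tie-breaking. -/
theorem exists_forall_mem_S [Finite 𝒜] [Nonempty 𝒜] (hk : PosSemidefKernel s.k)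
    (hσ : 0 < s.σ) (hB : 0 ≤ s.B) (hε : 0 < s.ε) (hδ : s.δ ∈ Set.Ioo (0 : ℝ) 1) (hLx : 0 < s.Lx)
    (X : Set E) (n : ℕ) :
    ∃ n' ≥ n, ∀ (e : ℕ → Fin (q + 1) → ℝ) (pick : ℕ → Set 𝒜 → 𝒜),
      (∀ n c, c.Nonempty → pick n c ∈ c) →
      ∀ a, (∀ j, s.roll a j ∈ (s.run e pick n).safeStates s X) → a ∈ (s.run e pick n').S := by
  have hβ := monotone_sqrtBeta hk hσ
  choose T hT hgrow using exists_forall_S_ssubset (s := s) hk hσ hB hε hδ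
  have hTn : ∀ j, n ≤ T^[j] n := fun j => by
    induction j with
    | zero => exact le_rfl
    | succ j ih => rw [Function.iterate_succ_apply']; exact ih.trans (hT _)
  -- Until `a` is included, each application of `T` adds a parameter, and there are only `Nat.card
  -- 𝒜` of them.
  refine ⟨T^[Nat.card 𝒜 + 1] n, hTn _, fun e pick hpick a ha => ?_⟩
  have key : ∀ j, a ∈ (s.run e pick (T^[j] n)).S ∨ j ≤ (s.run e pick (T^[j] n)).S.ncard := by
    intro j
    induction j with
    | zero => exact Or.inr (Nat.zero_le _)
    | succ j ih =>
      rw [Function.iterate_succ_apply']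
      refine or_iff_not_imp_left.2 fun haS => ?_
      have hmem : ∀ k, n ≤ k → k ≤ T (T^[j] n) → a ∉ (s.run e pick k).S :=
        fun k _ hk' h => haS ((refines_run hβ hk').S h)
      have hlt := Set.ncard_lt_ncard (hgrow (T^[j] n) e pick hpick fun k h1 h2 =>
        ⟨a, mem_geCand_run hβ hLx ha ((hTn j).trans h1) (hmem k ((hTn j).trans h1) h2)⟩)
        (Set.toFinite _)
      have := ih.resolve_left (hmem _ (hTn j) (hT _))
      omega
  refine (key _).resolve_right fun h => ?_
  have := Set.ncard_le_card (s.run e pick (T^[Nat.card 𝒜 + 1] n)).S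
  omega

end Setup

end Algorithm

/-- The quadratic form of the Gram matrix at `w` is the squared norm of the combination of the
kernel functions at the points `z j` with weights `w j`. -/
theorem posSemidefKernel_kernel (H : Type*) {Z : Type*} [NormedAddCommGroup H]
    [InnerProductSpace ℝ H] [CompleteSpace H] [RKHS ℝ H Z ℝ] :
    PosSemidefKernel fun a b : Z => RKHS.kernel H a b 1 := by
  intro ι _ _ z
  have hker : ∀ a b : Z, RKHS.kernel H a b 1 =
      inner ℝ (RKHS.kerFun H b (1 : ℝ)) (RKHS.kerFun H a (1 : ℝ)) := fun a b => by
    rw [← RKHS.kernel_inner]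
    simp
  refine Matrix.PosSemidef.of_dotProduct_mulVec_nonneg ?_ fun w => ?_
  · ext i j
    simp only [gram, Matrix.conjTranspose_apply, Matrix.of_apply, star_trivial, hker]
    exact real_inner_comm _ _
  · have : star w ⬝ᵥ (gram (fun a b : Z => RKHS.kernel H a b 1) z).mulVec w =
        inner ℝ (∑ j, w j • RKHS.kerFun H (z j) (1 : ℝ)) (∑ i, w i • RKHS.kerFun H (z i) (1 : ℝ)) := by
      rw [sum_inner, Finset.sum_congr rfl fun j _ => inner_sum _ _ _, Finset.sum_comm]
      simp only [dotProduct, Matrix.mulVec, gram, Matrix.of_apply, star_trivial, hker,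
        real_inner_smul_left, real_inner_smul_right, Finset.mul_sum]
      refine Finset.sum_congr rfl fun i _ => Finset.sum_congr rfl fun j _ => ?_
      ring
    rw [this]
    exact real_inner_self_nonneg

end GoSafeOpt

theorem mainTheorem5
    {P E V : Type*}
    [NormedAddCommGroup P] [NormedSpace ℝ P] [FiniteDimensional ℝ P]
    [NormedAddCommGroup E] [NormedSpace ℝ E] [FiniteDimensional ℝ E]
    [NormedAddCommGroup V] [NormedSpace ℝ V] [FiniteDimensional ℝ V]
    -- finite parameter set, state space, input space, initial state
    (A : Finset P) (X : Set E) (U : Set V) (x₀ : E) (hx₀ : x₀ ∈ X)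
    -- Lipschitz continuous dynamics, parameterized policy, trajectories from `x₀`
    (z : E → V → E)
    (hz : ∃ K : ℝ≥0, LipschitzOnWith K (fun p : E × V => z p.1 p.2) (X ×ˢ U))
    (π : E → P → V) (hπ : ∀ x ∈ X, ∀ a ∈ A, π x a ∈ U)
    (x : A → ℝ → E) (hx : ∀ a : A, GoSafeOpt.IsTrajectory X z π a x₀ (x a))
    -- objective and constraints; `g i a y` is the value of the constraint for the start state `y`
    (q : ℕ) (f : A → ℝ) (g : Fin q → A → E → ℝ)
    -- a nonempty set of safe parameters is known
    (S₀ : Set A) (hS₀ : S₀.Nonempty) (hsafe : ∀ a ∈ S₀, ∀ i, 0 ≤ g i a x₀)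
    -- `h` is an element of an RKHS with norm at most `B`
    {H : Type*} [NormedAddCommGroup H] [InnerProductSpace ℝ H] [CompleteSpace H]
    [RKHS ℝ H (A × Fin (q + 1)) ℝ]
    (h : H) (B : ℝ) (hB : ‖h‖ ≤ B)
    (hf : ∀ a, h (a, 0) = f a) (hg : ∀ a (i : Fin q), h (a, i.succ) = g i a x₀)
    -- Lipschitz continuity with known constants
    (La Lx : ℝ) (hLa : 0 ≤ La) (hLx : 0 < Lx)
    (hfLip : ∀ a b, |f a - f b| ≤ La * ‖(a : P) - b‖)
    (hgLip : ∀ i a b, |g i a x₀ - g i b x₀| ≤ La * ‖(a : P) - b‖)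
    (hgLipx : ∀ i a, ∀ y ∈ X, ∀ y' ∈ X, |g i a y - g i a y'| ≤ Lx * ‖y - y'‖)
    -- i.i.d. `σ`-sub-Gaussian measurement noise
    {Ω : Type*} [MeasurableSpace Ω] (Pr : Measure Ω) [IsProbabilityMeasure Pr]
    (σ : ℝ) (hσ : 0 < σ) (noise : ℕ × Fin (q + 1) → Ω → ℝ)
    (hindep : iIndepFun noise Pr) (hident : ∀ m, IdentDistrib (noise m) (noise (0, 0)) Pr Pr)
    (hsub : ∀ m, HasSubgaussianMGF (noise m) (σ ^ 2).toNNReal Pr)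
    -- bounded motion between two measurements of the state
    (Δt : ℝ) (hΔt : 0 < Δt) (Xi : ℝ)
    (hjump : ∀ a ∈ A, ∀ y ∈ X, ∀ ξ : ℝ → E, GoSafeOpt.IsTrajectory X z π a y ξ →
      ∀ ρ ∈ Set.Icc (0 : ℝ) 1, ‖ξ (ρ * Δt) - y‖ ≤ Xi)
    -- precision, failure probability, tie-breaking in the acquisition functions
    (ε : ℝ) (hε : 0 < ε) (δ : ℝ) (hδ : δ ∈ Set.Ioo (0 : ℝ) 1)
    (pick : Ω → ℕ → Set A → A) (hpick : ∀ ω n c, c.Nonempty → pick ω n c ∈ c)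
    -- the algorithm and its state at iteration `n`
    (s : GoSafeOpt.Setup A E q)
    (hs : s = { k := fun a b => RKHS.kernel H a b 1, h := h, roll := fun a j => x a (j * Δt)
                x₀ := x₀, S₀ := S₀, La := La, Lx := Lx, Xi := Xi
                ε := ε, σ := σ, B := B, δ := δ })
    (run : Ω → ℕ → GoSafeOpt.State A E q)
    (hrun : ∀ ω, run ω = s.run (fun n i => noise (n, i) ω) (pick ω))
    -- the safe global optimum
    (aOpt : A) (hOpt : GoSafeOpt.IsSafeOptimum f (fun i a => g i a x₀) aOpt)
    (n : ℕ) :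
    ∃ n' ≥ n, ∃ Ev : Set Ω, MeasurableSet Ev ∧ ENNReal.ofReal (1 - δ) ≤ Pr Ev ∧
      ∀ ω ∈ Ev,
        (∃ aGE : A, aGE ∉ (run ω n).S ∧
          (∀ j : ℕ, x aGE (j * Δt) ∈ (run ω n).safeStates s X) ∧
          aOpt ∈ GoSafeOpt.reachClosure (fun i a => g i a x₀) La ε {aGE}) →
        (run ω n').Discoverable s aOpt := by
  obtain ⟨a₀, -⟩ := hS₀
  have : Nonempty A := ⟨a₀⟩
  have hreach := GoSafeOpt.Setup.exists_forall_mem_S (s := s)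
    (by rw [hs]; exact GoSafeOpt.posSemidefKernel_kernel H) (by rw [hs]; exact hσ)
    (by rw [hs]; exact (norm_nonneg h).trans hB) (by rw [hs]; exact hε) (by rw [hs]; exact hδ)
    (by rw [hs]; exact hLx) X n
  obtain ⟨n', hn', hmem⟩ := hreach
  -- The confidence widths and the non-triggering of the boundary condition do not depend on the
  -- values of the noise, so that the claim holds on every sample path.
  refine ⟨n', hn', Set.univ, MeasurableSet.univ, ?_, ?_⟩
  · rw [measure_univ, ENNReal.ofReal_le_one]
    linarith [hδ.1]
  · rintro ω - ⟨aGE, -, hroll, hopt⟩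
    rw [hrun] at hroll ⊢
    refine ⟨{aGE}, Set.singleton_subset_iff.2 (hmem _ _ (hpick ω) aGE fun j => ?_), ?_⟩
    · have hj : s.roll aGE j = x aGE (j * Δt) := by rw [hs]
      rw [hj]
      exact hroll j
    · rw [hs]
      simpa only [hg] using hopt
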